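/- For integers $k,n\ge 1$ let $$h_k^{(n)}=\sum_{i=1}^{k}\frac{1}{(2i-1)^n},\qquad h_k=h_k^{(1)},$$ and let $\zeta$ denote the Riemann zeta function. Then the series $$s(2)=\sum_{k=1}^{\infty}\frac{h_k\,h_k^{(2)}}{k^{5}}$$ converges, and $$s(2)=\frac{651}{8}\,\zeta(3)\zeta(5)-\frac{343}{16}\,\zeta(2)\zeta(3)^2-\frac{1575}{32}\,\zeta(8).$$ -/

import Mathlib

/-- The odd-type (hyper-)harmonic number `h_k^{(n)} = ∑_{i=1}^k 1 / (2 i - 1)^n`;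
`h_k` stands for `h_k^{(1)}`. -/
noncomputable def oddHarmonic (n k : ℕ) : ℝ :=
  ∑ i ∈ Finset.Icc 1 k, 1 / (2 * (i : ℝ) - 1) ^ n

/-- The summand `h_k h_k^{(2)} / k^{2n+1}`. -/
noncomputable def oddEulerTerm (n k : ℕ) : ℝ :=
  oddHarmonic 1 k * oddHarmonic 2 k / (k : ℝ) ^ (2 * n + 1)

/-- The nonlinear sum `s(n) = ∑_{k=1}^∞ h_k h_k^{(2)} / k^{2n+1}`; the summation index is shifted,
so that it runs over `k + 1` with `k = 0, 1, 2, …`. -/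
noncomputable def oddEulerSum (n : ℕ) : ℝ :=
  ∑' k : ℕ, oddEulerTerm n (k + 1)

/-!
Write `K` for a positive integer, `a`, `b` for positive odd integers, and `t p = ∑ 1 / a ^ p`
(`oddZeta p`). Two telescoping series over the odd integers,

* `h_K = 4 K ^ 2 ∑_b 1 / (b (4 K ^ 2 - b ^ 2))` (`hasSum_oddHarmonic_one`),
* `h_K^{(2)} = 4 K ∑_a a / (4 K ^ 2 - a ^ 2) ^ 2` (`hasSum_oddHarmonic_two`),

turn `s(2)` into `16` times the absolutely convergent triple series of
`a / (b K ^ 2 (4 K ^ 2 - a ^ 2) ^ 2 (4 K ^ 2 - b ^ 2))` (`summable_oddEulerTriple`).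

Here the sum over `K` may be taken first. Partial fractions in `4 K ^ 2` reduce it to `ζ(2)` and
to the sums of `1 / (4 K ^ 2 - a ^ 2) ^ r` for `r = 1, 2, 3`; these are polynomials in `1 / a`
with coefficients in `ℚ[π ^ 2]`, because `2 K - a` runs through all odd integers when `K` runs
through `ℤ`, and the negative `K` contribute the poles at `-a`. The outcome (`hasSum_oddEulerTriple`) is a combination of monomials in `1 / a`
and `1 / b`, a term supported on the diagonal `a = b`, and, off the diagonal, a multiple of
`1 / (a ^ 3 b (a ^ 2 - b ^ 2))`. Exchanging `a` and `b` and averaging replaces the last one by a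
multiple of `1 / (a ^ 3 b ^ 3)` (`oddEulerDouble_add_swap`). Every remaining series is a product
of values of `t`, which gives

`s(2) = 96 t 3 t 5 - (14 π ^ 2 / 3) (t 3) ^ 2 - 5 π ^ 2 t 6` (`hasSum_oddEulerTerm_two`).

The claim follows from `t p = (1 - 2 ^ (-p)) ζ(p)` and the values of `ζ` at `2`, `6` and `8`.
-/

open Filter Topology

/-! ### Series -/

theorem HasSum.of_eq_of_eq {ι : Type*} {f g : ι → ℝ} {s t : ℝ} (h : HasSum f s)
    (hfg : ∀ i, g i = f i) (hst : t = s) : HasSum g t := by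
  rwa [hst, funext hfg]

/-- A telescoping series with step `K`. -/
theorem hasSum_sub_shift {f : ℕ → ℝ} (K : ℕ) (hf : Tendsto f atTop (𝓝 0))
    (hs : Summable fun i => f i - f (i + K)) :
    HasSum (fun i => f i - f (i + K)) (∑ i ∈ Finset.range K, f i) := by
  rw [hs.hasSum_iff_tendsto_nat]
  have h : ∀ N, ∑ i ∈ Finset.range N, (f i - f (i + K)) =
      ∑ i ∈ Finset.range K, f i - ∑ i ∈ Finset.range K, f (N + i) := by
    intro N
    have h1 := Finset.sum_range_add f N K
    have h2 := Finset.sum_range_add f K N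
    rw [add_comm K N] at h2
    rw [Finset.sum_sub_distrib]
    simp only [add_comm _ K]
    linarith
  simp only [h]
  have : Tendsto (fun N => ∑ i ∈ Finset.range K, f (N + i)) atTop
      (𝓝 (∑ i ∈ Finset.range K, (0 : ℝ))) :=
    tendsto_finsetSum _ fun i _ => hf.comp (tendsto_add_atTop_nat i)
  simpa using tendsto_const_nhds.sub this

/-! ### Sums over the odd integers and zeta values -/

/-- The sum `∑ 1 / a ^ p` over the positive odd integers `a`. -/
noncomputable def oddZeta (p : ℕ) : ℝ := ∑' i : ℕ, 1 / (2 * (i : ℝ) + 1) ^ p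

theorem hasSum_oddZeta {p : ℕ} (hp : 1 < p) :
    HasSum (fun i : ℕ => 1 / (2 * (i : ℝ) + 1) ^ p) (oddZeta p) := by
  have h := (Real.summable_one_div_nat_pow.2 hp).comp_injective
    (i := fun i : ℕ => 2 * i + 1) (fun a b h => by simpa using h)
  exact Summable.hasSum (by simpa [Function.comp_def] using h)

theorem oddZeta_eq_riemannZeta {p : ℕ} (hp : 1 < p) :
    (oddZeta p : ℂ) = (1 - 1 / 2 ^ p) * riemannZeta p := by
  have hs := Real.summable_one_div_nat_pow.2 hp
  have he : HasSum (fun i : ℕ => 1 / ((2 * i : ℕ) : ℝ) ^ p)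
      (1 / 2 ^ p * ∑' n : ℕ, 1 / (n : ℝ) ^ p) := by
    refine HasSum.of_eq_of_eq (hs.hasSum.mul_left (1 / 2 ^ p : ℝ)) (fun i => ?_) rfl
    push_cast
    rw [mul_pow, one_div_mul_one_div]
  have ho : HasSum (fun i : ℕ => 1 / ((2 * i + 1 : ℕ) : ℝ) ^ p) (oddZeta p) := by
    simpa using hasSum_oddZeta hp
  have h := (HasSum.even_add_odd (f := fun i : ℕ => 1 / (i : ℝ) ^ p) he ho).unique hs.hasSum
  have hz : riemannZeta p = ((∑' n : ℕ, 1 / (n : ℝ) ^ p : ℝ) : ℂ) := by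
    rw [zeta_nat_eq_tsum_of_gt_one hp, Complex.ofReal_tsum]
    simp only [Complex.ofReal_div, Complex.ofReal_one, Complex.ofReal_pow, Complex.ofReal_natCast]
  rw [hz]
  generalize ∑' n : ℕ, 1 / (n : ℝ) ^ p = Z at h
  have h' : oddZeta p = (1 - 1 / 2 ^ p) * Z := by linarith
  rw [h']
  push_cast
  ring

theorem bernoulli'_six : bernoulli' 6 = 1 / 42 := by
  have h5 : bernoulli' 5 = 0 := bernoulli'_eq_zero_of_odd (by decide) (by norm_num)
  rw [bernoulli'_def]
  norm_num [Finset.sum_range_succ, h5, show Nat.choose 6 2 = 15 from rfl,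
    show Nat.choose 6 4 = 15 from rfl]

theorem bernoulli'_eight : bernoulli' 8 = -1 / 30 := by
  have h5 : bernoulli' 5 = 0 := bernoulli'_eq_zero_of_odd (by decide) (by norm_num)
  have h7 : bernoulli' 7 = 0 := bernoulli'_eq_zero_of_odd (by decide) (by norm_num)
  rw [bernoulli'_def]
  norm_num [Finset.sum_range_succ, h5, h7, bernoulli'_six,
    show Nat.choose 8 2 = 28 from rfl, show Nat.choose 8 4 = 70 from rfl,
    show Nat.choose 8 6 = 28 from rfl]

theorem riemannZeta_six : riemannZeta 6 = (Real.pi : ℂ) ^ 6 / 945 := by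
  have h := riemannZeta_two_mul_nat (k := 3) (by norm_num)
  norm_num [bernoulli_eq_bernoulli'_of_ne_one, bernoulli'_six, Nat.factorial] at h
  rw [h]
  ring

theorem riemannZeta_eight : riemannZeta 8 = (Real.pi : ℂ) ^ 8 / 9450 := by
  have h := riemannZeta_two_mul_nat (k := 4) (by norm_num)
  norm_num [bernoulli_eq_bernoulli'_of_ne_one, bernoulli'_eight, Nat.factorial] at h
  rw [h]
  ring

theorem oddZeta_two : oddZeta 2 = Real.pi ^ 2 / 8 := by
  have h := oddZeta_eq_riemannZeta (p := 2) (by norm_num)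
  push_cast at h
  rw [riemannZeta_two] at h
  have : (oddZeta 2 : ℂ) = ((Real.pi ^ 2 / 8 : ℝ) : ℂ) := by
    rw [h]
    push_cast
    ring
  exact_mod_cast this

/-! ### Sums over the even integers with odd poles -/

theorem one_le_abs_even_sub_odd (k i : ℤ) : 1 ≤ |2 * (k : ℝ) - (2 * i + 1)| := by
  have h : (1 : ℤ) ≤ |2 * k - (2 * i + 1)| := Int.one_le_abs (by omega)
  exact_mod_cast h

theorem even_sub_odd_ne_zero (k i : ℤ) : 2 * (k : ℝ) - (2 * i + 1) ≠ 0 :=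
  abs_pos.1 (one_pos.trans_le (one_le_abs_even_sub_odd k i))

theorem even_sq_sub_odd_sq_eq_mul (k i : ℕ) :
    4 * ((k : ℝ) + 1) ^ 2 - (2 * (i : ℝ) + 1) ^ 2 =
      (2 * ((k : ℝ) + 1) - (2 * i + 1)) * (2 * ((k : ℝ) + 1) + (2 * i + 1)) := by
  ring

theorem even_sq_sub_odd_sq_ne_zero (k i : ℕ) :
    4 * ((k : ℝ) + 1) ^ 2 - (2 * (i : ℝ) + 1) ^ 2 ≠ 0 := by
  have h := even_sub_odd_ne_zero (k + 1) i
  push_cast at h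
  have h2 : 2 * ((k : ℝ) + 1) + (2 * (i : ℝ) + 1) ≠ 0 := by positivity
  rw [even_sq_sub_odd_sq_eq_mul]
  exact mul_ne_zero h h2

theorem hasSum_int_odd {p : ℕ} (hp : 1 < p) :
    HasSum (fun n : ℤ => 1 / (2 * (n : ℝ) + 1) ^ p) ((1 + (-1) ^ p) * oddZeta p) := by
  rw [add_mul, one_mul]
  refine HasSum.of_nat_of_neg_add_one (by simpa using hasSum_oddZeta hp) ?_
  refine HasSum.of_eq_of_eq ((hasSum_oddZeta hp).mul_left ((-1 : ℝ) ^ p)) (fun i => ?_) rfl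
  push_cast
  have : 2 * (-((i : ℝ) + 1)) + 1 = -1 * (2 * i + 1) := by ring
  rw [this, mul_pow, mul_one_div, div_mul_eq_div_div, one_div]
  rcases neg_one_pow_eq_or ℝ p with h | h <;> simp [h]

/-- Translation invariance of the sum over all odd integers, written as a sum over the positive
even integers `2 (k + 1)`. -/
theorem hasSum_even_sub_odd_add {p : ℕ} (hp : 1 < p) (i : ℕ) :
    HasSum (fun k : ℕ => 1 / (2 * ((k : ℝ) + 1) - (2 * i + 1)) ^ p +
        (-1) ^ p / (2 * ((k : ℝ) + 1) + (2 * i + 1)) ^ p)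
      ((1 + (-1) ^ p) * oddZeta p - (-1) ^ p / (2 * (i : ℝ) + 1) ^ p) := by
  have hneg : ∀ x : ℝ, 1 / (-x) ^ p = (-1) ^ p / x ^ p := by
    intro x
    rw [neg_pow, div_mul_eq_div_div]
    rcases neg_one_pow_eq_or ℝ p with h | h <;> simp [h]
  have h := ((Equiv.addRight (-(i : ℤ) - 1)).hasSum_iff.2 (hasSum_int_odd hp)).nat_add_neg
  rw [← hasSum_nat_add_iff' 1] at h
  have h0 : 2 * (((0 : ℤ) + (-(i : ℤ) - 1) : ℤ) : ℝ) + 1 = -(2 * i + 1) := by push_cast; ring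
  refine HasSum.of_eq_of_eq (h) (fun k => ?_) ?_
  · simp only [Function.comp, Equiv.coe_addRight]
    rw [← hneg]
    congr 3 <;> push_cast <;> ring
  · simp only [Function.comp, Equiv.coe_addRight, Finset.sum_range_one, Nat.cast_zero, neg_zero,
      h0, hneg]
    ring

theorem summable_one_div_even_sub_odd_sq (i : ℕ) :
    Summable (fun k : ℕ => 1 / (4 * ((k : ℝ) + 1) ^ 2 - (2 * (i : ℝ) + 1) ^ 2)) := by
  have h := (hasSum_even_sub_odd_add (p := 2) (by norm_num) i).summable
  refine Summable.of_norm_bounded h fun k => ?_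
  have e : 1 / (4 * ((k : ℝ) + 1) ^ 2 - (2 * (i : ℝ) + 1) ^ 2) =
      1 / (2 * ((k : ℝ) + 1) - (2 * i + 1)) * (1 / (2 * ((k : ℝ) + 1) + (2 * i + 1))) := by
    rw [one_div_mul_one_div]
    congr 1
    ring
  have e2 : ∀ x y : ℝ, 1 / x ^ 2 + (-1) ^ 2 / y ^ 2 = (1 / x) ^ 2 + (1 / y) ^ 2 := by
    intro x y
    rw [one_div_pow, one_div_pow]
    norm_num
  rw [e, e2, Real.norm_eq_abs, abs_le]
  constructor <;> nlinarith [sq_nonneg (1 / (2 * ((k : ℝ) + 1) - (2 * i + 1)) +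
    (1 / (2 * ((k : ℝ) + 1) + (2 * i + 1)))), sq_nonneg (1 / (2 * ((k : ℝ) + 1) - (2 * i + 1)) -
    (1 / (2 * ((k : ℝ) + 1) + (2 * i + 1)))), sq_nonneg (1 / (2 * ((k : ℝ) + 1) - (2 * i + 1))),
    sq_nonneg (1 / (2 * ((k : ℝ) + 1) + (2 * i + 1)))]

/-- The partial fraction expansion of the cotangent at an odd multiple of `π / 2`, where the
cotangent vanishes. -/
theorem hasSum_one_div_even_sq_sub_odd_sq (i : ℕ) :
    HasSum (fun k : ℕ => 1 / (4 * ((k : ℝ) + 1) ^ 2 - (2 * (i : ℝ) + 1) ^ 2))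
      (1 / (2 * (2 * (i : ℝ) + 1) ^ 2)) := by
  have ha : 2 * (i : ℝ) + 1 ≠ 0 := by positivity
  have hterm : ∀ k : ℕ, 1 / (2 * ((k : ℝ) + 1) - (2 * i + 1)) -
      1 / (2 * (((k + (2 * i + 1) : ℕ) : ℝ) + 1) - (2 * i + 1)) =
      2 * (2 * (i : ℝ) + 1) * (1 / (4 * ((k : ℝ) + 1) ^ 2 - (2 * (i : ℝ) + 1) ^ 2)) := by
    intro k
    have h1 := even_sub_odd_ne_zero (k + 1) i
    push_cast at h1 ⊢
    have h2 : 2 * ((k : ℝ) + 1) + (2 * i + 1) ≠ 0 := by positivity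
    have h3 : 2 * ((k : ℝ) + (2 * i + 1) + 1) - (2 * i + 1) =
      2 * ((k : ℝ) + 1) + (2 * i + 1) := by ring
    rw [h3, even_sq_sub_odd_sq_eq_mul]
    field_simp
    ring
  have hlim : Tendsto (fun k : ℕ => 1 / (2 * ((k : ℝ) + 1) - (2 * i + 1))) atTop (𝓝 0) := by
    simp only [one_div]
    refine tendsto_inv_atTop_zero.comp ?_
    refine tendsto_atTop_add_const_right _ _ ?_
    exact (tendsto_atTop_add_const_right _ _ tendsto_natCast_atTop_atTop).const_mul_atTop
      (by norm_num)
  -- the terms of the telescoped sum cancel in pairs, except the last one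
  have hsum : ∑ k ∈ Finset.range (2 * i + 1), 1 / (2 * ((k : ℝ) + 1) - (2 * i + 1)) =
      1 / (2 * (i : ℝ) + 1) := by
    rw [Finset.sum_range_succ]
    have hr := Finset.sum_range_reflect
      (fun k : ℕ => 1 / (2 * ((k : ℝ) + 1) - (2 * i + 1))) (2 * i)
    have hr' : ∑ k ∈ Finset.range (2 * i),
        1 / (2 * (((2 * i - 1 - k : ℕ) : ℝ) + 1) - (2 * i + 1)) =
        -∑ k ∈ Finset.range (2 * i), 1 / (2 * ((k : ℝ) + 1) - (2 * i + 1)) := by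
      rw [← Finset.sum_neg_distrib]
      refine Finset.sum_congr rfl fun k hk => ?_
      have hk := Finset.mem_range.1 hk
      rw [Nat.sub_sub, Nat.cast_sub (by omega), ← one_div_neg_eq_neg_one_div]
      congr 1
      push_cast
      ring
    have : 2 * (((2 * i : ℕ) : ℝ) + 1) - (2 * i + 1) = 2 * i + 1 := by push_cast; ring
    rw [this]
    linarith
  have hs := (summable_one_div_even_sub_odd_sq i).mul_left (2 * (2 * (i : ℝ) + 1))
  have h := hasSum_sub_shift (2 * i + 1) hlim (by simpa only [hterm] using hs)
  simp only [hterm, hsum] at h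
  refine HasSum.of_eq_of_eq (h.mul_left (1 / (2 * (2 * (i : ℝ) + 1)))) (fun k => ?_) ?_
  · rw [← mul_assoc, one_div_mul_cancel (by positivity), one_mul]
  · field_simp

/-- With `x = 1 / (2 K - a)` and `y = 1 / (2 K + a)` the summand is `(x - y) ^ 2 / (4 a ^ 2)`, and
`x * y` is summed by `hasSum_one_div_even_sq_sub_odd_sq`. -/
theorem hasSum_one_div_even_sq_sub_odd_sq_sq (i : ℕ) :
    HasSum (fun k : ℕ => 1 / (4 * ((k : ℝ) + 1) ^ 2 - (2 * (i : ℝ) + 1) ^ 2) ^ 2)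
      (Real.pi ^ 2 / (16 * (2 * (i : ℝ) + 1) ^ 2) - 1 / (2 * (2 * (i : ℝ) + 1) ^ 4)) := by
  have ha : 2 * (i : ℝ) + 1 ≠ 0 := by positivity
  have h := ((hasSum_even_sub_odd_add (p := 2) (by norm_num) i).sub
    ((hasSum_one_div_even_sq_sub_odd_sq i).mul_left 2)).mul_left (1 / (4 * (2 * (i : ℝ) + 1) ^ 2))
  rw [oddZeta_two] at h
  refine HasSum.of_eq_of_eq (h) (fun k => ?_) ?_
  · have h1 := even_sub_odd_ne_zero (k + 1) i
    push_cast at h1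
    have h2 : 2 * ((k : ℝ) + 1) + (2 * i + 1) ≠ 0 := by positivity
    rw [even_sq_sub_odd_sq_eq_mul]
    field_simp
    ring
  · field_simp
    ring

/-- With `x = 1 / (2 K - a)` and `y = 1 / (2 K + a)`, so that `x - y = 2 a x y`, the summand is
`(x ^ 3 - y ^ 3 - 6 a (x y) ^ 2) / (8 a ^ 3)`. -/
theorem hasSum_one_div_even_sq_sub_odd_sq_cube (i : ℕ) :
    HasSum (fun k : ℕ => 1 / (4 * ((k : ℝ) + 1) ^ 2 - (2 * (i : ℝ) + 1) ^ 2) ^ 3)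
      (1 / (2 * (2 * (i : ℝ) + 1) ^ 6) - 3 * Real.pi ^ 2 / (64 * (2 * (i : ℝ) + 1) ^ 4)) := by
  have ha : 2 * (i : ℝ) + 1 ≠ 0 := by positivity
  have h := ((hasSum_even_sub_odd_add (p := 3) (by norm_num) i).sub
    ((hasSum_one_div_even_sq_sub_odd_sq_sq i).mul_left (6 * (2 * (i : ℝ) + 1)))).mul_left
      (1 / (8 * (2 * (i : ℝ) + 1) ^ 3))
  refine HasSum.of_eq_of_eq (h) (fun k => ?_) ?_
  · have h1 := even_sub_odd_ne_zero (k + 1) i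
    push_cast at h1
    have h2 : 2 * ((k : ℝ) + 1) + (2 * i + 1) ≠ 0 := by positivity
    rw [even_sq_sub_odd_sq_eq_mul]
    field_simp
    ring
  · field_simp
    ring

/-! ### Odd harmonic numbers as series over the odd integers -/

theorem oddHarmonic_eq_sum_range (n K : ℕ) :
    oddHarmonic n K = ∑ i ∈ Finset.range K, 1 / (2 * (i : ℝ) + 1) ^ n := by
  induction K with
  | zero => simp [oddHarmonic]
  | succ K ih =>
    rw [Finset.sum_range_succ, ← ih, oddHarmonic, Finset.sum_Icc_succ_top (by omega), oddHarmonic]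
    congr 3
    push_cast
    ring

theorem sum_inv_odd_shift (K : ℕ) (p : ℕ) :
    ∑ i ∈ Finset.range K, 1 / (2 * (i : ℝ) + 1 - 2 * K) ^ p =
      (-1) ^ p * oddHarmonic p K := by
  rw [oddHarmonic_eq_sum_range, Finset.mul_sum,
    ← Finset.sum_range_reflect (fun i : ℕ => (-1) ^ p * (1 / (2 * (i : ℝ) + 1) ^ p)) K]
  refine Finset.sum_congr rfl fun i hi => ?_
  have hi := Finset.mem_range.1 hi
  rw [Nat.sub_sub, Nat.cast_sub (by omega)]
  have : 2 * (i : ℝ) + 1 - 2 * K = (-1) * (2 * ((K : ℝ) - ((1 + i : ℕ) : ℝ)) + 1) := by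
    push_cast
    ring
  rw [this, mul_pow, div_mul_eq_div_div]
  rcases neg_one_pow_eq_or ℝ p with h | h <;> simp [h, neg_div]

theorem abs_odd_mul_even_sq_sub_odd_sq_le (k i : ℕ) :
    |1 / ((2 * (i : ℝ) + 1) * (4 * ((k : ℝ) + 1) ^ 2 - (2 * (i : ℝ) + 1) ^ 2))| ≤
      1 / (2 * (i : ℝ) + 1) ^ 2 := by
  have ha : 0 < 2 * (i : ℝ) + 1 := by positivity
  have h1 := one_le_abs_even_sub_odd (k + 1) i
  push_cast at h1
  rw [abs_div, abs_one, even_sq_sub_odd_sq_eq_mul, abs_mul, abs_mul, abs_of_pos ha,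
    abs_of_pos (show 0 < 2 * ((k : ℝ) + 1) + (2 * i + 1) by positivity)]
  refine one_div_le_one_div_of_le (by positivity) ?_
  rw [sq]
  refine mul_le_mul_of_nonneg_left ?_ ha.le
  have h2 : 2 * (i : ℝ) + 1 ≤ 2 * ((k : ℝ) + 1) + (2 * i + 1) := by
    have : (0 : ℝ) ≤ k := by positivity
    linarith
  calc 2 * (i : ℝ) + 1 ≤ 1 * (2 * ((k : ℝ) + 1) + (2 * i + 1)) := by linarith
    _ ≤ _ := mul_le_mul_of_nonneg_right h1 (by positivity)

theorem tendsto_one_div_two_mul_add (c : ℝ) :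
    Tendsto (fun i : ℕ => 1 / (2 * (i : ℝ) + 1 - c)) atTop (𝓝 0) := by
  simp only [one_div, sub_eq_add_neg]
  refine tendsto_inv_atTop_zero.comp ?_
  refine tendsto_atTop_add_const_right _ _ (tendsto_atTop_add_const_right _ _ ?_)
  exact tendsto_natCast_atTop_atTop.const_mul_atTop (by norm_num)

/-- `h_K` as a series over the odd integers: the terms are
`(1 / a - 1 / (a + 2 K)) + (1 / a - 1 / (a - 2 K))` up to a factor, and both differences
telescope. -/
theorem hasSum_oddHarmonic_one (k : ℕ) :
    HasSum (fun i : ℕ =>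
        1 / ((2 * (i : ℝ) + 1) * (4 * ((k : ℝ) + 1) ^ 2 - (2 * (i : ℝ) + 1) ^ 2)))
      (oddHarmonic 1 (k + 1) / (4 * ((k : ℝ) + 1) ^ 2)) := by
  have hs : Summable fun i : ℕ =>
      1 / ((2 * (i : ℝ) + 1) * (4 * ((k : ℝ) + 1) ^ 2 - (2 * (i : ℝ) + 1) ^ 2)) :=
    (hasSum_oddZeta (p := 2) (by norm_num)).summable.of_norm_bounded
      fun i => abs_odd_mul_even_sq_sub_odd_sq_le k i
  have hKcast : ((k + 1 : ℕ) : ℝ) = (k : ℝ) + 1 := by push_cast; ring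
  have hs1 : Summable fun i : ℕ =>
      1 / (2 * (i : ℝ) + 1) - 1 / (2 * ((i + (k + 1) : ℕ) : ℝ) + 1) := by
    refine ((hasSum_oddZeta (p := 2) (by norm_num)).summable.mul_left
      (2 * ((k : ℝ) + 1))).of_nonneg_of_le (fun i => ?_) (fun i => ?_)
    · rw [sub_nonneg]
      refine one_div_le_one_div_of_le (by positivity) ?_
      push_cast
      have : (0 : ℝ) ≤ k := by positivity
      linarith
    · rw [div_sub_div _ _ (by positivity) (by positivity), mul_one_div]
      push_cast
      have : 1 * (2 * ((i : ℝ) + (k + 1)) + 1) - (2 * i + 1) * 1 = 2 * ((k : ℝ) + 1) := by ring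
      rw [this]
      refine div_le_div_of_nonneg_left (by positivity) (by positivity) ?_
      rw [sq]
      refine mul_le_mul_of_nonneg_left ?_ (by positivity)
      have : (0 : ℝ) ≤ k := by positivity
      linarith
  have hterm : ∀ i : ℕ, 1 / (2 * (i : ℝ) + 1 - 2 * ((k : ℝ) + 1)) -
      1 / (2 * ((i + (k + 1) : ℕ) : ℝ) + 1 - 2 * ((k : ℝ) + 1)) =
      (1 / (2 * (i : ℝ) + 1) - 1 / (2 * ((i + (k + 1) : ℕ) : ℝ) + 1)) - 8 * ((k : ℝ) + 1) ^ 2 *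
        (1 / ((2 * (i : ℝ) + 1) * (4 * ((k : ℝ) + 1) ^ 2 - (2 * (i : ℝ) + 1) ^ 2))) := by
    intro i
    have h1 := even_sub_odd_ne_zero (k + 1) i
    push_cast at h1 ⊢
    have h2 : 2 * ((k : ℝ) + 1) + (2 * i + 1) ≠ 0 := by positivity
    have e1 : 2 * (i : ℝ) + 1 - 2 * ((k : ℝ) + 1) =
      -(2 * ((k : ℝ) + 1) - (2 * i + 1)) := by ring
    have e2 : 2 * ((i : ℝ) + (k + 1)) + 1 - 2 * ((k : ℝ) + 1) = 2 * i + 1 := by ring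
    have e3 : 2 * ((i : ℝ) + (k + 1)) + 1 = 2 * ((k : ℝ) + 1) + (2 * i + 1) := by ring
    rw [e1, e2, e3, even_sq_sub_odd_sq_eq_mul]
    field_simp
    ring
  have hlim := tendsto_one_div_two_mul_add
  have h1 := hasSum_sub_shift (f := fun i : ℕ => 1 / (2 * (i : ℝ) + 1)) (k + 1)
    (by simpa using hlim 0) hs1
  have h2 := hasSum_sub_shift (k + 1) (hlim (2 * ((k : ℝ) + 1)))
    (by simpa only [hterm] using hs1.sub (hs.mul_left (8 * ((k : ℝ) + 1) ^ 2)))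
  have e1 : ∑ i ∈ Finset.range (k + 1), 1 / (2 * (i : ℝ) + 1) = oddHarmonic 1 (k + 1) := by
    simp only [oddHarmonic_eq_sum_range, pow_one]
  have e2 : ∑ i ∈ Finset.range (k + 1), 1 / (2 * (i : ℝ) + 1 - 2 * ((k : ℝ) + 1)) =
      -oddHarmonic 1 (k + 1) := by
    have := sum_inv_odd_shift (k + 1) 1
    simp only [hKcast] at this
    simpa using this
  rw [e1] at h1
  rw [e2] at h2
  simp only [hterm] at h2
  refine HasSum.of_eq_of_eq ((h1.sub h2).mul_left (1 / (8 * ((k : ℝ) + 1) ^ 2)))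
    (fun i => ?_) ?_
  · rw [sub_sub_cancel, ← mul_assoc, one_div_mul_cancel (by positivity), one_mul]
  · field_simp
    ring

/-- `h_K^{(2)}` as a series over the odd integers: up to a factor the terms are the telescoping
differences `1 / (a - 2 K) ^ 2 - 1 / (a + 2 K) ^ 2`. -/
theorem hasSum_oddHarmonic_two (k : ℕ) :
    HasSum (fun i : ℕ =>
        (2 * (i : ℝ) + 1) / (4 * ((k : ℝ) + 1) ^ 2 - (2 * (i : ℝ) + 1) ^ 2) ^ 2)
      (oddHarmonic 2 (k + 1) / (4 * ((k : ℝ) + 1))) := by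
  have hKcast : ((k + 1 : ℕ) : ℝ) = (k : ℝ) + 1 := by push_cast; ring
  have h2K : 2 * (k + 1) = (k + 1) + (k + 1) := by ring
  have hS : Summable fun i : ℕ => 1 / (2 * (i : ℝ) + 1 - 2 * ((k : ℝ) + 1)) ^ 2 := by
    rw [← summable_nat_add_iff (f := fun i : ℕ => 1 / (2 * (i : ℝ) + 1 - 2 * ((k : ℝ) + 1)) ^ 2)
      (k + 1)]
    refine (hasSum_oddZeta (p := 2) (by norm_num)).summable.congr fun i => ?_
    push_cast
    congr 2
    ring
  have h := hasSum_sub_shift (f := fun i : ℕ => 1 / (2 * (i : ℝ) + 1 - 2 * ((k : ℝ) + 1)) ^ 2)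
    (2 * (k + 1)) hS.tendsto_atTop_zero (hS.sub ((summable_nat_add_iff
      (f := fun i : ℕ => 1 / (2 * (i : ℝ) + 1 - 2 * ((k : ℝ) + 1)) ^ 2) (2 * (k + 1))).2 hS))
  have e : ∑ i ∈ Finset.range (2 * (k + 1)), 1 / (2 * (i : ℝ) + 1 - 2 * ((k : ℝ) + 1)) ^ 2 =
      2 * oddHarmonic 2 (k + 1) := by
    rw [h2K, Finset.sum_range_add]
    have h1 := sum_inv_odd_shift (k + 1) 2
    simp only [hKcast] at h1
    rw [h1, two_mul (oddHarmonic 2 (k + 1))]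
    congr 1
    · norm_num
    · rw [oddHarmonic_eq_sum_range]
      refine Finset.sum_congr rfl fun i _ => ?_
      push_cast
      congr 2
      ring
  rw [e] at h
  refine HasSum.of_eq_of_eq (h.mul_left (1 / (8 * ((k : ℝ) + 1)))) (fun i => ?_) ?_
  · have h1 := even_sub_odd_ne_zero (k + 1) i
    push_cast at h1 ⊢
    have h2 : 2 * ((k : ℝ) + 1) + (2 * i + 1) ≠ 0 := by positivity
    have e1 : 2 * (i : ℝ) + 1 - 2 * ((k : ℝ) + 1) =
      -(2 * ((k : ℝ) + 1) - (2 * i + 1)) := by ring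
    have e2 : 2 * ((i : ℝ) + 2 * (k + 1)) + 1 - 2 * ((k : ℝ) + 1) =
      2 * ((k : ℝ) + 1) + (2 * i + 1) := by ring
    rw [e1, e2, even_sq_sub_odd_sq_eq_mul]
    field_simp
    ring
  · field_simp
    ring

theorem oddHarmonic_two_le (K : ℕ) : oddHarmonic 2 K ≤ K := by
  rw [oddHarmonic_eq_sum_range]
  calc ∑ i ∈ Finset.range K, 1 / (2 * (i : ℝ) + 1) ^ 2 ≤ ∑ i ∈ Finset.range K, (1 : ℝ) := by
        refine Finset.sum_le_sum fun i _ => ?_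
        rw [div_le_one (by positivity)]
        exact one_le_pow₀ (by linarith [show (0 : ℝ) ≤ i by positivity])
    _ = K := by simp

/-! ### The triple series -/

/-- The summand of the triple series for `s(2) / 16`: with `K = k + 1`, `a = 2 i + 1` and
`b = 2 j + 1` it is `a / (b K ^ 2 (4 K ^ 2 - a ^ 2) ^ 2 (4 K ^ 2 - b ^ 2))`. -/
noncomputable def oddEulerTriple (k i j : ℕ) : ℝ :=
  (2 * (i : ℝ) + 1) / (4 * ((k : ℝ) + 1) ^ 2 - (2 * (i : ℝ) + 1) ^ 2) ^ 2 / ((k : ℝ) + 1) ^ 2 *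
    (1 / ((2 * (j : ℝ) + 1) * (4 * ((k : ℝ) + 1) ^ 2 - (2 * (j : ℝ) + 1) ^ 2)))

theorem hasSum_one_div_succ_sq :
    HasSum (fun k : ℕ => 1 / ((k : ℝ) + 1) ^ 2) (Real.pi ^ 2 / 6) := by
  have h := (hasSum_nat_add_iff' (f := fun n : ℕ => 1 / (n : ℝ) ^ 2) 1).2 hasSum_zeta_two
  simpa using h

/-- Absolute convergence: the factor containing `b` is at most `1 / b ^ 2`, and the sum over `a` of
the other one is `h_K^{(2)} / (4 K ^ 3) ≤ 1 / (4 K ^ 2)`. -/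
theorem summable_oddEulerTriple :
    Summable fun x : (ℕ × ℕ) × ℕ => oddEulerTriple x.1.1 x.1.2 x.2 := by
  have hg : Summable fun x : ℕ × ℕ =>
      (2 * (x.2 : ℝ) + 1) / (4 * ((x.1 : ℝ) + 1) ^ 2 - (2 * (x.2 : ℝ) + 1) ^ 2) ^ 2 /
        ((x.1 : ℝ) + 1) ^ 2 := by
    rw [summable_prod_of_nonneg (fun x => by positivity)]
    have hf := fun k : ℕ => (hasSum_oddHarmonic_two k).div_const (((k : ℝ) + 1) ^ 2)
    refine ⟨fun k => (hf k).summable, ?_⟩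
    have ht := fun k : ℕ => (hf k).tsum_eq
    simp only [ht]
    refine hasSum_one_div_succ_sq.summable.of_nonneg_of_le (fun k => ?_) (fun k => ?_)
    · rw [oddHarmonic_eq_sum_range]
      positivity
    · refine div_le_div_of_nonneg_right ?_ (by positivity)
      rw [div_le_one (by positivity)]
      have := oddHarmonic_two_le (k + 1)
      push_cast at this
      linarith [show (0 : ℝ) ≤ k by positivity]
  have hb := (hasSum_oddZeta (p := 2) (by norm_num)).summable
  refine (hg.mul_of_nonneg hb (fun x => by positivity)
    (fun x => by positivity)).of_norm_bounded fun x => ?_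
  rw [oddEulerTriple, Real.norm_eq_abs, abs_mul, abs_of_nonneg (by positivity)]
  exact mul_le_mul_of_nonneg_left (abs_odd_mul_even_sq_sub_odd_sq_le _ _) (by positivity)

/-- The value of `oddEulerTriple` summed over `k`. In the first summand division by zero gives
`0` on the diagonal `i = j`. -/
noncomputable def oddEulerDouble (i j : ℕ) : ℝ :=
  Real.pi ^ 2 / 4 * (1 / ((2 * (i : ℝ) + 1) ^ 3 * (2 * (j : ℝ) + 1) *
      ((2 * (i : ℝ) + 1) ^ 2 - (2 * (j : ℝ) + 1) ^ 2)))
    - Real.pi ^ 2 / 6 * (1 / (2 * (i : ℝ) + 1) ^ 3 * (1 / (2 * (j : ℝ) + 1) ^ 3))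
    + 2 * (1 / (2 * (i : ℝ) + 1) ^ 3 * (1 / (2 * (j : ℝ) + 1) ^ 5))
    + 4 * (1 / (2 * (i : ℝ) + 1) ^ 5 * (1 / (2 * (j : ℝ) + 1) ^ 3))
    - 7 * Real.pi ^ 2 / 16 * (if i = j then 1 / (2 * (i : ℝ) + 1) ^ 6 else 0)

theorem odd_sq_sub_odd_sq_ne_zero {i j : ℕ} (h : i ≠ j) :
    (2 * (i : ℝ) + 1) ^ 2 - (2 * (j : ℝ) + 1) ^ 2 ≠ 0 := by
  have e : (2 * (i : ℝ) + 1) ^ 2 - (2 * (j : ℝ) + 1) ^ 2 =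
      ((i : ℝ) - j) * (4 * ((i : ℝ) + j + 1)) := by ring
  rw [e]
  exact mul_ne_zero (sub_ne_zero.2 (by exact_mod_cast h)) (by positivity)

/-- Partial fractions in `4 K ^ 2` reduce the sum over `k` to `ζ(2)` and the sums of the powers of
`1 / (4 K ^ 2 - a ^ 2)`. -/
theorem hasSum_oddEulerTriple (i j : ℕ) :
    HasSum (fun k : ℕ => oddEulerTriple k i j) (oddEulerDouble i j) := by
  have hz := hasSum_one_div_succ_sq
  have h1 := hasSum_one_div_even_sq_sub_odd_sq i
  have h2 := hasSum_one_div_even_sq_sub_odd_sq_sq i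
  have h3 := hasSum_one_div_even_sq_sub_odd_sq_cube i
  have h1' := hasSum_one_div_even_sq_sub_odd_sq j
  have hv := fun k => even_sq_sub_odd_sq_ne_zero k i
  have hv' := fun k => even_sq_sub_odd_sq_ne_zero k j
  have ha : 2 * (i : ℝ) + 1 ≠ 0 := by positivity
  have hb : 2 * (j : ℝ) + 1 ≠ 0 := by positivity
  have hab := fun h : i ≠ j => odd_sq_sub_odd_sq_ne_zero h
  unfold oddEulerTriple oddEulerDouble
  rcases eq_or_ne i j with rfl | hij
  · simp only [if_true, sub_self, mul_zero, div_zero]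
    generalize 2 * (i : ℝ) + 1 = a at *
    refine HasSum.of_eq_of_eq ((((h3.mul_left (4 / a ^ 2)).sub (h2.mul_left (4 / a ^ 4))).add
      (h1.mul_left (4 / a ^ 6))).sub (hz.mul_left (1 / a ^ 6))) (fun k => ?_) ?_
    · have hk : (k : ℝ) + 1 ≠ 0 := by positivity
      have hv := hv k
      generalize (k : ℝ) + 1 = K at *
      field_simp
      ring
    · field_simp
      ring
  · have hab := hab hij
    simp only [hij, if_false]
    generalize 2 * (i : ℝ) + 1 = a at *
    generalize 2 * (j : ℝ) + 1 = b at *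
    refine HasSum.of_eq_of_eq ((((h2.mul_left (4 / (a * b * (a ^ 2 - b ^ 2)))).sub
      (h1.mul_left (4 * a / b * (1 / (b ^ 2 * (a ^ 2 - b ^ 2) ^ 2) - 1 / (a ^ 4 * b ^ 2))))).add
      (h1'.mul_left (4 * a / (b ^ 3 * (a ^ 2 - b ^ 2) ^ 2)))).sub
      (hz.mul_left (1 / (a ^ 3 * b ^ 3)))) (fun k => ?_) ?_
    · have hk : (k : ℝ) + 1 ≠ 0 := by positivity
      have hv := hv k
      have hv' := hv' k
      generalize (k : ℝ) + 1 = K at *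
      field_simp
      ring
    · field_simp
      ring

/-! ### Symmetrisation of the double series -/

theorem hasSum_oddZeta_mul {p q : ℕ} (hp : 1 < p) (hq : 1 < q) :
    HasSum (fun x : ℕ × ℕ => 1 / (2 * (x.1 : ℝ) + 1) ^ p * (1 / (2 * (x.2 : ℝ) + 1) ^ q))
      (oddZeta p * oddZeta q) :=
  (hasSum_oddZeta hp).mul (hasSum_oddZeta hq)
    ((hasSum_oddZeta hp).summable.mul_of_nonneg (hasSum_oddZeta hq).summable
      (fun x => by positivity) (fun x => by positivity))

theorem hasSum_oddZeta_diag {p : ℕ} (hp : 1 < p) :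
    HasSum (fun x : ℕ × ℕ => if x.1 = x.2 then 1 / (2 * (x.1 : ℝ) + 1) ^ p else 0)
      (oddZeta p) := by
  have hinj : Function.Injective fun i : ℕ => (i, i) := fun a b h => (Prod.ext_iff.1 h).1
  rw [← hinj.hasSum_iff]
  · simpa [Function.comp_def] using hasSum_oddZeta hp
  · rintro ⟨a, b⟩ h
    have : a ≠ b := fun hab => h ⟨a, by simp [hab]⟩
    simp [this]

/-- The only summand that does not split into a product of single series is
`1 / (a ^ 3 b (a ^ 2 - b ^ 2))`; it becomes `-1 / (a ^ 3 b ^ 3)` upon adding the same term with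
`a` and `b` exchanged. -/
theorem oddEulerDouble_add_swap (i j : ℕ) :
    oddEulerDouble i j + oddEulerDouble j i =
      6 * (1 / (2 * (i : ℝ) + 1) ^ 3 * (1 / (2 * (j : ℝ) + 1) ^ 5))
      + 6 * (1 / (2 * (i : ℝ) + 1) ^ 5 * (1 / (2 * (j : ℝ) + 1) ^ 3))
      - 7 * Real.pi ^ 2 / 12 * (1 / (2 * (i : ℝ) + 1) ^ 3 * (1 / (2 * (j : ℝ) + 1) ^ 3))
      - 5 * Real.pi ^ 2 / 8 * (if i = j then 1 / (2 * (i : ℝ) + 1) ^ 6 else 0) := by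
  have ha : 2 * (i : ℝ) + 1 ≠ 0 := by positivity
  have hb : 2 * (j : ℝ) + 1 ≠ 0 := by positivity
  unfold oddEulerDouble
  rcases eq_or_ne i j with rfl | hij
  · simp only [if_true, sub_self, mul_zero, div_zero]
    field_simp
    ring
  · have hab := odd_sq_sub_odd_sq_ne_zero hij
    simp only [hij, hij.symm, if_false]
    generalize 2 * (i : ℝ) + 1 = a at *
    generalize 2 * (j : ℝ) + 1 = b at *
    have hba : b ^ 2 - a ^ 2 = -(a ^ 2 - b ^ 2) := by ring
    rw [hba]
    field_simp
    ring

theorem hasSum_oddEulerTerm_two :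
    HasSum (fun k : ℕ => oddEulerTerm 2 (k + 1))
      (96 * oddZeta 3 * oddZeta 5 - 14 * Real.pi ^ 2 / 3 * oddZeta 3 ^ 2
        - 5 * Real.pi ^ 2 * oddZeta 6) := by
  obtain ⟨s, hs⟩ := summable_oddEulerTriple
  have hk : HasSum (fun k : ℕ => oddEulerTerm 2 (k + 1)) (16 * s) := by
    have h1 : HasSum (fun x : ℕ × ℕ => (2 * (x.2 : ℝ) + 1) /
        (4 * ((x.1 : ℝ) + 1) ^ 2 - (2 * (x.2 : ℝ) + 1) ^ 2) ^ 2 / ((x.1 : ℝ) + 1) ^ 2 *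
          (oddHarmonic 1 (x.1 + 1) / (4 * ((x.1 : ℝ) + 1) ^ 2))) s :=
      hs.prod_fiberwise fun x => (hasSum_oddHarmonic_one x.1).mul_left _
    have h2 : HasSum (fun k : ℕ => oddHarmonic 2 (k + 1) / (4 * ((k : ℝ) + 1)) /
        ((k : ℝ) + 1) ^ 2 * (oddHarmonic 1 (k + 1) / (4 * ((k : ℝ) + 1) ^ 2))) s :=
      h1.prod_fiberwise fun k =>
        ((hasSum_oddHarmonic_two k).div_const (((k : ℝ) + 1) ^ 2)).mul_right _
    refine HasSum.of_eq_of_eq (h2.mul_left 16) (fun k => ?_) rfl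
    rw [oddEulerTerm]
    push_cast
    field_simp
    ring
  have hperm : HasSum (fun x : (ℕ × ℕ) × ℕ => oddEulerTriple x.2 x.1.1 x.1.2) s :=
    ((Equiv.prodComm (ℕ × ℕ) ℕ).trans (Equiv.prodAssoc ℕ ℕ ℕ).symm).hasSum_iff
      (f := fun x : (ℕ × ℕ) × ℕ => oddEulerTriple x.1.1 x.1.2 x.2) |>.2 hs
  have hij : HasSum (fun x : ℕ × ℕ => oddEulerDouble x.1 x.2) s :=
    hperm.prod_fiberwise fun x => hasSum_oddEulerTriple x.1 x.2
  have hji : HasSum (fun x : ℕ × ℕ => oddEulerDouble x.2 x.1) s :=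
    (Equiv.prodComm ℕ ℕ).hasSum_iff
      (f := fun x : ℕ × ℕ => oddEulerDouble x.1 x.2) |>.2 hij
  have hsym := hij.add hji
  simp only [oddEulerDouble_add_swap] at hsym
  have hval := hsym.unique
    (((((hasSum_oddZeta_mul (p := 3) (q := 5) (by norm_num) (by norm_num)).mul_left 6).add
      ((hasSum_oddZeta_mul (p := 5) (q := 3) (by norm_num) (by norm_num)).mul_left 6)).sub
      ((hasSum_oddZeta_mul (p := 3) (q := 3) (by norm_num) (by norm_num)).mul_left
        (7 * Real.pi ^ 2 / 12))).sub
      ((hasSum_oddZeta_diag (p := 6) (by norm_num)).mul_left (5 * Real.pi ^ 2 / 8)))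
  -- the symmetrised double series sums to `2 s`, the series in question to `16 s`
  refine HasSum.of_eq_of_eq hk (fun _ => rfl) ?_
  linear_combination (-8) * hval

theorem mainTheorem6 :
    Summable (fun k : ℕ => oddEulerTerm 2 (k + 1)) ∧
      (oddEulerSum 2 : ℂ) =
        651 / 8 * riemannZeta 3 * riemannZeta 5
          - 343 / 16 * riemannZeta 2 * riemannZeta 3 ^ 2
          - 1575 / 32 * riemannZeta 8 := by
  refine ⟨hasSum_oddEulerTerm_two.summable, ?_⟩
  have h3 := oddZeta_eq_riemannZeta (p := 3) (by norm_num)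
  have h5 := oddZeta_eq_riemannZeta (p := 5) (by norm_num)
  have h6 := oddZeta_eq_riemannZeta (p := 6) (by norm_num)
  push_cast at h3 h5 h6
  rw [oddEulerSum, hasSum_oddEulerTerm_two.tsum_eq]
  push_cast
  rw [h3, h5, h6, riemannZeta_two, riemannZeta_six, riemannZeta_eight]
  ring
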